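/- Let $\Pi$ be a L\'evy measure on $\mathbb{R}^d$, i.e. a $\sigma$-finite Borel measure with $\Pi(\{0\})=0$ and $\int (1\wedge|x|^2)\,\Pi(dx)<\infty$, such that $\Pi(\{x:|x|=1\})=0$, and let $X=\{X(t):t\ge 0\}$ be an $\mathbb{R}^d$-valued L\'evy process with $$E\,e^{i\langle u,X(1)\rangle}=\exp\Bigl(\int\bigl(e^{i\langle u,x\rangle}-1-i\langle u,x\rangle I(|x|\le 1)\bigr)\,\Pi(dx)\Bigr),\qquad u\in\mathbb{R}^d .$$ Let $\{\eta_{n,j}: n,j\ge 1\}$ be $\mathbb{R}^d$-valued random vectors on a probability space with $\Pr(\eta_{n,j}\ne 0)=1$ (no assumption on their dependence is made), let $c_n\in\mathbb{R}^d$, and put $X_n(t)=\sum_{1\le j\le nt}\eta_{n,j}-tc_n$ for $t\ge 0$. Let $E=[-\infty,\infty]^d\setminus\{0\}$, extend $\Pi$ to $E$ by giving mass $0$ to the points with an infinite coordinate, and let $M_p(E)$ be the space of integer-valued Radon measures on $E$ with the vague topology. Let $N'$ be a Poisson point process on $E$ with mean measure $\Pi$. Suppose that, with $\epsilon_x$ the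 unit mass at $x$, $$N_n':=\sum_{j=1}^n\epsilon_{\eta_{n,j}}\xrightarrow{d}N'\quad\text{in } M_p(E)$$ and that for every $\delta>0$ $$\lim_{\varepsilon\to 0}\limsup_{n\to\infty}\Pr\Bigl(\Bigl|\sum_{j=1}^n\eta_{n,j}I(|\eta_{n,j}|\le\varepsilon)-c_n+\int_{\{x:\varepsilon<|x|\le 1\}}x\,\Pi(dx)\Bigr|\ge\delta\Bigr)=0,$$ where the limit is taken over all $\varepsilon>0$ with $\Pi(\{x:|x|=\varepsilon\})=0$. Then $X_n(1)\xrightarrow{d}X(1)$ in $\mathbb{R}^d$. -/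

import Mathlib

open MeasureTheory ProbabilityTheory Filter Topology
open scoped ENNReal NNReal CompactlySupported

/-- A point measure on `Z`: a Borel measure that is finite on compact sets and takes values in
`{0, 1, 2, ..., ∞}`. -/
structure PointMeasure (Z : Type*) [TopologicalSpace Z] [MeasurableSpace Z] where
  toMeasure : Measure Z
  finite_compact : ∀ K : Set Z, IsCompact K → toMeasure K < ∞
  integer_valued : ∀ B : Set Z, MeasurableSet B → ∃ k : ℕ∞, toMeasure B = (k : ℝ≥0∞)

/-- The vague topology: the coarsest topology for which `m ↦ ∫ f dm` is continuous for every
nonnegative continuous `f` with compact support. -/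
noncomputable instance PointMeasure.instTopologicalSpace (Z : Type*) [TopologicalSpace Z] [MeasurableSpace Z] :
    TopologicalSpace (PointMeasure Z) :=
  ⨅ f : C_c(Z, ℝ≥0),
    TopologicalSpace.induced (fun m : PointMeasure Z => ∫ z, (f z : ℝ) ∂m.toMeasure) inferInstance

noncomputable instance PointMeasure.instMeasurableSpace (Z : Type*) [TopologicalSpace Z] [MeasurableSpace Z] :
    MeasurableSpace (PointMeasure Z) :=
  borel (PointMeasure Z)

instance PointMeasure.instBorelSpace (Z : Type*) [TopologicalSpace Z] [MeasurableSpace Z] :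
    BorelSpace (PointMeasure Z) :=
  ⟨rfl⟩

/-- `N` is a Poisson (point) process with mean measure `Q`. -/
structure IsPoissonProcess {Z Ω : Type*} [TopologicalSpace Z] [MeasurableSpace Z]
    [MeasurableSpace Ω] (N : Ω → PointMeasure Z) (Q : Measure Z) (P : Measure Ω) : Prop where
  measurable : Measurable N
  indep : ∀ (l : ℕ) (A : Fin l → Set Z), (∀ i, MeasurableSet (A i)) →
    Pairwise (fun i j => Disjoint (A i) (A j)) →
    iIndepFun (fun i ω => (N ω).toMeasure (A i)) P
  law : ∀ A : Set Z, MeasurableSet A → Q A < ∞ →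
    HasLaw (fun ω => (N ω).toMeasure A)
      ((poissonMeasure (Q A).toNNReal).map (fun k : ℕ => (k : ℝ≥0∞))) P

/-- The extended punctured space `[-∞, ∞]^d \ {0}`, with its subspace topology. -/
abbrev Punctured (d : ℕ) : Type := {x : Fin d → EReal // x ≠ 0}

theorem measurableEmbedding_puncturedVal (d : ℕ) :
    MeasurableEmbedding (Subtype.val : Punctured d → Fin d → EReal) :=
  MeasurableEmbedding.subtype_coe (measurableSet_singleton (0 : Fin d → EReal)).compl

/-- The inclusion of `ℝ^d` into `[-∞, ∞]^d`. -/
def toExtended {d : ℕ} (x : EuclideanSpace ℝ (Fin d)) : Fin d → EReal := fun i => (x i : EReal)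

theorem measurable_toExtended {d : ℕ} :
    Measurable (toExtended : EuclideanSpace ℝ (Fin d) → Fin d → EReal) := by
  unfold toExtended
  exact measurable_pi_lambda _ fun i => by fun_prop

/-- A measure on `ℝ^d`, restricted to `ℝ^d \ {0}` and regarded as a measure on
`[-∞, ∞]^d \ {0}` that does not charge the points with an infinite coordinate. -/
noncomputable def puncturedExtension {d : ℕ} (μ : Measure (EuclideanSpace ℝ (Fin d))) :
    Measure (Punctured d) :=
  (μ.map toExtended).comap Subtype.val

theorem puncturedExtension_apply {d : ℕ} (μ : Measure (EuclideanSpace ℝ (Fin d)))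
    {B : Set (Punctured d)} (hB : MeasurableSet B) :
    puncturedExtension μ B =
      μ {x | ∃ h : toExtended x ≠ 0, (⟨toExtended x, h⟩ : Punctured d) ∈ B} := by
  have emb := measurableEmbedding_puncturedVal d
  have hB' : MeasurableSet (Subtype.val '' B : Set (Fin d → EReal)) :=
    emb.measurableSet_image.2 hB
  rw [puncturedExtension, emb.comap_apply,
    Measure.map_apply measurable_toExtended hB']
  congr 1
  ext x
  simp

/-- The point measure `∑_{1 ≤ j ≤ n} ε_{x_j}` on `[-∞, ∞]^d \ {0}`; points `x_j = 0`, which do not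
belong to that space, are not counted. -/
noncomputable def pointSum {d : ℕ} (n : ℕ) (x : ℕ → EuclideanSpace ℝ (Fin d)) :
    PointMeasure (Punctured d) where
  toMeasure := puncturedExtension (∑ j ∈ Finset.Icc 1 n, Measure.dirac (x j))
  finite_compact := fun K hK => by
    rw [puncturedExtension_apply _ hK.isClosed.measurableSet]
    exact measure_lt_top _ _
  integer_valued := fun B hB => by
    have hB' : MeasurableSet (toExtended ⁻¹' (Subtype.val '' B) :
        Set (EuclideanSpace ℝ (Fin d))) :=
      measurable_toExtended ((measurableEmbedding_puncturedVal d).measurableSet_image.2 hB)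
    rw [puncturedExtension_apply _ hB]
    have e : {y : EuclideanSpace ℝ (Fin d) |
        ∃ h : toExtended y ≠ 0, (⟨toExtended y, h⟩ : Punctured d) ∈ B} =
        toExtended ⁻¹' (Subtype.val '' B) := by
      ext y
      simp
    rw [e, Measure.finsetSum_apply]
    classical
    refine ⟨∑ j ∈ Finset.Icc 1 n, if x j ∈ toExtended ⁻¹' (Subtype.val '' B) then 1 else 0, ?_⟩
    rw [← ENat.toENNRealRingHom_apply, map_sum]
    refine Finset.sum_congr rfl fun j _ => ?_
    rw [Measure.dirac_apply' _ hB']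
    by_cases h : x j ∈ toExtended ⁻¹' (Subtype.val '' B) <;> simp [h, Set.indicator]

/-- A Lévy measure on `ℝ^d`. -/
structure IsLevyMeasure {d : ℕ} (ν : Measure (EuclideanSpace ℝ (Fin d))) : Prop where
  sigmaFinite : SigmaFinite ν
  zero : ν {0} = 0
  lintegral_lt_top : ∫⁻ x, ENNReal.ofReal (min 1 (‖x‖ ^ 2)) ∂ν < ∞

/-- A Lévy process with values in `ℝ^d`: it starts at `0`, has stationary independent increments
and right-continuous paths with left limits. -/
structure IsLevyProcess {d : ℕ} {Ω : Type*} [MeasurableSpace Ω]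
    (X : ℝ≥0 → Ω → EuclideanSpace ℝ (Fin d)) (P : Measure Ω) : Prop where
  measurable : ∀ t, Measurable (X t)
  zero : ∀ᵐ ω ∂P, X 0 ω = 0
  indep : HasIndepIncrements X P
  stationary : ∀ s t : ℝ≥0, IdentDistrib (fun ω => X (s + t) ω - X s ω)
    (fun ω => X t ω - X 0 ω) P P
  cadlag : ∀ᵐ ω ∂P, ∀ t : ℝ≥0, ContinuousWithinAt (fun s => X s ω) (Set.Ici t) t ∧
    ∃ y, Tendsto (fun s => X s ω) (𝓝[<] t) (𝓝 y)

/-- The Lévy–Khintchine exponent without drift and without Gaussian part,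
`∫ (e^{i⟨u,x⟩} - 1 - i⟨u,x⟩ I(|x| ≤ 1)) ν(dx)`. -/
noncomputable def levyExponent {d : ℕ} (ν : Measure (EuclideanSpace ℝ (Fin d)))
    (u : EuclideanSpace ℝ (Fin d)) : ℂ :=
  ∫ x, (Complex.exp (Complex.I * (inner ℝ u x : ℝ)) - 1
    - (if ‖x‖ ≤ 1 then Complex.I * (inner ℝ u x : ℝ) else 0)) ∂ν

/-- The partial sum process `X_n(t) = ∑_{1 ≤ j ≤ nt} η_{n,j} - t c_n`. -/
noncomputable def partialSumProcess {d : ℕ} {Ω : Type*}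
    (η : ℕ → ℕ → Ω → EuclideanSpace ℝ (Fin d)) (c : ℕ → EuclideanSpace ℝ (Fin d))
    (n : ℕ) (t : ℝ≥0) (ω : Ω) : EuclideanSpace ℝ (Fin d) :=
  (∑ j ∈ Finset.Icc 1 ⌊(n : ℝ≥0) * t⌋₊, η n j ω) - t • c n

/-! By Lévy's continuity theorem it is enough to prove, for each `u`, convergence of the
characteristic function of `X_n(1)` at `u`. Fix a radius `ε` whose sphere is `ν`-null and let `b` be
the integral of `x` over `ε < |x| ≤ 1`. Then `⟨u, X_n(1)⟩` is the sum of `⟨u, η⟩` over the large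
jumps `|η| > ε`, minus `⟨u, b⟩`, plus a remainder which the small-jump hypothesis makes small in
probability (`norm_integral_exp_add_sub_le`).

The large-jump sum depends only on the point process, so no independence of the `η n j` is needed.
If the summand were a continuous function vanishing near `0` on the compactified space, the
continuous mapping theorem and the characteristic functional of a Poisson process
(`IsPoissonProcess.integral_exp_integral`) would give the limit at once. The actual summand jumps at
`|x| = ε` and is unbounded; `tendsto_integral_exp_largeJumps` replaces it by a compactly supported
one, the error being the chance that a point falls near the sphere or near infinity.

With the factor `exp(-i⟨u, b⟩)`, the limit in `n` is the exponential of the Lévy–Khintchine integral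
over `|x| > ε`. Dominated convergence as `ε → 0` then yields `levyExponent`. -/

theorem norm_exp_I_mul_sub_one_le_two (y : ℝ) : ‖Complex.exp (Complex.I * y) - 1‖ ≤ 2 := by
  refine (norm_sub_le _ _).trans ?_
  rw [Complex.norm_exp_I_mul_ofReal]
  norm_num

/-! ### Characteristic functional of a Poisson process. -/

namespace IsPoissonProcess

variable {Z Ω : Type*} [TopologicalSpace Z] [MeasurableSpace Z] [MeasurableSpace Ω]
  {N : Ω → PointMeasure Z} {Q : Measure Z} {P : Measure Ω}

theorem ae_lt_top (hN : IsPoissonProcess N Q P) {A : Set Z} (hA : MeasurableSet A)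
    (hQA : Q A < ∞) : ∀ᵐ ω ∂P, (N ω).toMeasure A < ∞ := by
  have h := hN.law A hA hQA
  have hm : Measurable (fun x : ℝ≥0∞ => x < ∞) := measurableSet_Iio.mem
  rw [h.ae_iff hm, ae_map_iff (by fun_prop) measurableSet_Iio]
  exact .of_forall fun k => ENNReal.natCast_lt_top k

/-- The probability that a Poisson process charges a set is at most the mean measure of it. -/
theorem measure_ne_zero_le (hN : IsPoissonProcess N Q P) {A : Set Z}
    (hA : MeasurableSet A) (hQA : Q A < ∞) :
    P {ω | (N ω).toMeasure A ≠ 0} ≤ Q A := by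
  have h := hN.law A hA hQA
  have hs : MeasurableSet {x : ℝ≥0∞ | x ≠ 0} := (measurableSet_singleton 0).compl
  rw [h.measure_eq hs, Measure.map_apply (by fun_prop) hs]
  have e : ((fun k : ℕ => (k : ℝ≥0∞)) ⁻¹' {x : ℝ≥0∞ | x ≠ 0}) = {0}ᶜ := by
    ext k; simp
  rw [e, prob_compl_eq_one_sub (measurableSet_singleton 0), poissonMeasure_singleton]
  simp only [pow_zero, mul_one, Nat.factorial_zero, Nat.cast_one, div_one]
  rw [← ENNReal.ofReal_one, ← ENNReal.ofReal_sub _ (Real.exp_nonneg _)]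
  refine ENNReal.ofReal_le_of_le_toReal ?_
  have := Real.add_one_le_exp (-((Q A).toNNReal : ℝ))
  change _ ≤ ((Q A).toNNReal : ℝ)
  linarith

theorem integral_exp_measure (hN : IsPoissonProcess N Q P) {A : Set Z} (hA : MeasurableSet A)
    (hQA : Q A < ∞) (y : ℝ) :
    ∫ ω, Complex.exp (Complex.I * (((N ω).toMeasure.real A * y : ℝ) : ℂ)) ∂P
      = Complex.exp (Q.real A * (Complex.exp (Complex.I * y) - 1)) := by
  have h := hN.law A hA hQA
  have hm : Measurable (fun x : ℝ≥0∞ => Complex.exp (Complex.I * ((x.toReal * y : ℝ) : ℂ))) := by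
    fun_prop
  have := h.integral_comp hm.aestronglyMeasurable
  simp only [Function.comp_def] at this
  simp only [measureReal_def]
  rw [this, integral_map (by fun_prop) hm.aestronglyMeasurable]
  have key := charFun_map_cast_poissonMeasure (Q A).toNNReal y
  rw [charFun_apply, integral_map .of_discrete (by fun_prop)] at key
  simp only [Real.inner_apply] at key
  rw [mul_comm Complex.I]
  convert key using 3 with k
  · simp [mul_comm]
  · rfl

theorem integral_exp_sum [IsProbabilityMeasure P] (hN : IsPoissonProcess N Q P) {l : ℕ}
    (A : Fin l → Set Z) (hA : ∀ i, MeasurableSet (A i)) (hQA : ∀ i, Q (A i) < ∞)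
    (hd : Pairwise fun i j => Disjoint (A i) (A j)) (y : Fin l → ℝ) :
    ∫ ω, Complex.exp (Complex.I * ((∑ i, (N ω).toMeasure.real (A i) * y i : ℝ) : ℂ)) ∂P
      = Complex.exp (∑ i, Q.real (A i) * (Complex.exp (Complex.I * y i) - 1)) := by
  have hind := hN.indep l A hA hd
  have hm (i : Fin l) : Measurable (fun x : ℝ≥0∞ =>
      Complex.exp (Complex.I * ((x.toReal * y i : ℝ) : ℂ))) := by
    fun_prop
  have := hind.integral_fun_prod_comp (fun i => (hN.law (A i) (hA i) (hQA i)).aemeasurable)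
    (fun i => (hm i).aestronglyMeasurable)
  rw [Complex.exp_sum]
  simp_rw [← fun i => hN.integral_exp_measure (hA i) (hQA i) (y i)]
  simp only [measureReal_def]
  rw [← this]
  congr 1 with ω
  rw [← Complex.exp_sum, ← Finset.mul_sum]
  push_cast
  rfl

/-- The level sets of the nonzero values are disjoint and of finite mean measure, so independence
turns the left side into a product of Poisson characteristic functions. The value `0` is dropped,
since its level set may have infinite measure; it contributes nothing to either side. -/
theorem integral_exp_simpleFunc [IsProbabilityMeasure P] (hN : IsPoissonProcess N Q P)
    (f : SimpleFunc Z ℝ) {A : Set Z} (hA : MeasurableSet A) (hQA : Q A < ∞)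
    (hf : ∀ z, z ∉ A → f z = 0) :
    ∫ ω, Complex.exp (Complex.I * ((∫ z, f z ∂(N ω).toMeasure : ℝ) : ℂ)) ∂P
      = Complex.exp (∫ z, (Complex.exp (Complex.I * f z) - 1) ∂Q) := by
  classical
  have hint : ∀ m : Measure Z, m A < ∞ → Integrable f m := fun m hm => by
    refine SimpleFunc.integrable_iff_finMeasSupp.2 (SimpleFunc.finMeasSupp_iff_support.2 ?_)
    refine (measure_mono ?_).trans_lt hm
    intro z hz
    by_contra h
    exact hz (hf z h)
  set s := f.range.filter (· ≠ 0) with hs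
  let e : Fin s.card ≃ s := s.equivFin.symm
  let B : Fin s.card → Set Z := fun i => f ⁻¹' {(e i : ℝ)}
  have hB : ∀ i, MeasurableSet (B i) := fun i => f.measurableSet_preimage _
  have hBA : ∀ i, B i ⊆ A := fun i z hz => by
    by_contra h
    have h1 : f z = (e i : ℝ) := hz
    rw [hf z h] at h1
    exact (Finset.mem_filter.1 (e i).2).2 h1.symm
  have hd : Pairwise fun i j => Disjoint (B i) (B j) := fun i j hij => by
    refine Set.disjoint_left.2 fun z hz hz' => hij (e.injective (Subtype.ext ?_))
    exact (show f z = (e i : ℝ) from hz).symm.trans hz'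
  have key := hN.integral_exp_sum B hB (fun i => (measure_mono (hBA i)).trans_lt hQA) hd
    (fun i => (e i : ℝ))
  have hsum : ∀ {E : Type} [AddCommGroup E] [Module ℝ E] (m : Measure Z) (g : ℝ → E), g 0 = 0 →
      ∑ x ∈ f.range, m.real (f ⁻¹' {x}) • g x = ∑ i, m.real (B i) • g (e i : ℝ) := by
    intro E _ _ m g hg
    rw [e.sum_comp (fun x : s => m.real (f ⁻¹' {(x : ℝ)}) • g x),
      Finset.sum_coe_sort s (fun x => m.real (f ⁻¹' {x}) • g x), hs, Finset.sum_filter]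
    refine Finset.sum_congr rfl fun x _ => ?_
    by_cases hx : x = 0 <;> simp [hx, hg]
  have hL : ∀ᵐ ω ∂P, Complex.exp (Complex.I * ((∫ z, f z ∂(N ω).toMeasure : ℝ) : ℂ)) =
      Complex.exp (Complex.I *
        ((∑ i, (N ω).toMeasure.real (B i) * (e i : ℝ) : ℝ) : ℂ)) := by
    filter_upwards [hN.ae_lt_top hA hQA] with ω hω
    have h1 := SimpleFunc.map_integral f id (hint _ hω) rfl
    rw [hsum _ id rfl] at h1
    rw [← SimpleFunc.integral_eq_integral f (hint _ hω)]
    congr 3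
  have hR : ∫ z, (Complex.exp (Complex.I * f z) - 1) ∂Q =
      ∑ i, Q.real (B i) * (Complex.exp (Complex.I * (e i : ℝ)) - 1) := by
    let g : ℝ → ℂ := fun y => Complex.exp (Complex.I * y) - 1
    have hg : g 0 = 0 := by simp [g]
    have h1 := SimpleFunc.map_integral f g (hint _ hQA) hg
    rw [hsum _ g hg, SimpleFunc.integral_eq_integral _
      ((SimpleFunc.integrable_iff_finMeasSupp.1 (hint _ hQA)).map hg |> fun h =>
        SimpleFunc.integrable_iff_finMeasSupp.2 h)] at h1
    simpa [g] using h1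
  rw [integral_congr_ae hL, key, hR]

/-- The characteristic functional of a Poisson process. -/
theorem integral_exp_integral [IsProbabilityMeasure P] (hN : IsPoissonProcess N Q P)
    {f : Z → ℝ} (hfm : Measurable f) {C : ℝ} (hC : ∀ z, |f z| ≤ C)
    {A : Set Z} (hA : MeasurableSet A) (hQA : Q A < ∞) (hf : ∀ z, z ∉ A → f z = 0) :
    ∫ ω, Complex.exp (Complex.I * ((∫ z, f z ∂(N ω).toMeasure : ℝ) : ℂ)) ∂P
      = Complex.exp (∫ z, (Complex.exp (Complex.I * f z) - 1) ∂Q) := by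
  let F : ℕ → SimpleFunc Z ℝ := fun k =>
    SimpleFunc.approxOn f hfm Set.univ 0 (Set.mem_univ _) k
  have hFlim : ∀ z, Tendsto (fun k => F k z) atTop (𝓝 (f z)) := fun z =>
    SimpleFunc.tendsto_approxOn hfm (Set.mem_univ _) (by simp)
  have hFle : ∀ k z, ‖F k z‖ ≤ ‖f z‖ + ‖f z‖ := fun k z =>
    SimpleFunc.norm_approxOn_zero_le hfm (Set.mem_univ _) z k
  have hF0 : ∀ k z, z ∉ A → F k z = 0 := fun k z hz => by
    have := hFle k z
    rw [hf z hz] at this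
    simpa using this
  have hFC : ∀ k z, ‖F k z‖ ≤ A.indicator (fun _ => 2 * C) z := fun k z => by
    by_cases hz : z ∈ A
    · rw [Set.indicator_of_mem hz]
      have h1 := hFle k z
      have h2 := hC z
      rw [Real.norm_eq_abs (f z)] at h1
      linarith
    · rw [Set.indicator_of_notMem hz, hF0 k z hz, norm_zero]
  have hlim1 : ∀ᵐ ω ∂P, Tendsto (fun k => ∫ z, F k z ∂(N ω).toMeasure) atTop
      (𝓝 (∫ z, f z ∂(N ω).toMeasure)) := by
    filter_upwards [hN.ae_lt_top hA hQA] with ω hω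
    refine tendsto_integral_of_dominated_convergence (A.indicator (fun _ => 2 * C))
      (fun k => (F k).aestronglyMeasurable) ?_ (fun k => .of_forall (hFC k)) (.of_forall hFlim)
    exact (integrable_indicator_iff hA).2 (integrableOn_const hω.ne)
  -- Measurability is read off from the formula: the integral of a non-measurable function is `0` by
  -- convention, whereas an exponential never vanishes.
  have hmeas : ∀ k, AEStronglyMeasurable (fun ω =>
      Complex.exp (Complex.I * ((∫ z, F k z ∂(N ω).toMeasure : ℝ) : ℂ))) P := fun k => by
    have h1 := hN.integral_exp_simpleFunc (F k) hA hQA (hF0 k)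
    by_contra h
    rw [integral_non_aestronglyMeasurable h] at h1
    exact Complex.exp_ne_zero _ h1.symm
  have hexp : Continuous fun y : ℝ => Complex.exp (Complex.I * y) := by fun_prop
  have h1 : Tendsto (fun k => ∫ ω, Complex.exp
      (Complex.I * ((∫ z, F k z ∂(N ω).toMeasure : ℝ) : ℂ)) ∂P) atTop
      (𝓝 (∫ ω, Complex.exp (Complex.I * ((∫ z, f z ∂(N ω).toMeasure : ℝ) : ℂ)) ∂P)) := by
    refine tendsto_integral_of_dominated_convergence (fun _ => 1) hmeas (integrable_const _)
      (fun k => .of_forall fun ω => (Complex.norm_exp_I_mul_ofReal _).le) ?_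
    filter_upwards [hlim1] with ω hω
    exact (hexp.tendsto _).comp hω
  have h2 : Tendsto (fun k => ∫ z, (Complex.exp (Complex.I * F k z) - 1) ∂Q) atTop
      (𝓝 (∫ z, (Complex.exp (Complex.I * f z) - 1) ∂Q)) := by
    refine tendsto_integral_of_dominated_convergence (A.indicator (fun _ => (2 : ℝ)))
      (fun k => ?_) ((integrable_indicator_iff hA).2 (integrableOn_const hQA.ne))
      (fun k => .of_forall fun z => ?_)
      (.of_forall fun z => ((hexp.tendsto _).comp (hFlim z)).sub_const 1)
    · exact ((hexp.measurable.comp (F k).measurable).sub_const 1).aestronglyMeasurable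
    · by_cases hz : z ∈ A
      · rw [Set.indicator_of_mem hz]
        exact norm_exp_I_mul_sub_one_le_two _
      · rw [Set.indicator_of_notMem hz, hF0 k z hz]
        simp
  refine tendsto_nhds_unique h1 ?_
  simp_rw [fun k => hN.integral_exp_simpleFunc (F k) hA hQA (hF0 k)]
  exact (Complex.continuous_exp.tendsto _).comp h2

end IsPoissonProcess

/-! ### Test functions on the punctured compactification. -/

section Extended

variable {d : ℕ}

theorem isOpenEmbedding_toExtended :
    IsOpenEmbedding (toExtended : EuclideanSpace ℝ (Fin d) → Fin d → EReal) := by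
  have h : IsOpenEmbedding (Pi.map fun (_ : Fin d) (x : ℝ) => (x : EReal)) :=
    .piMap fun _ => EReal.isOpenEmbedding_coe
  exact h.comp (EuclideanSpace.equiv (Fin d) ℝ).toHomeomorph.isOpenEmbedding

@[simp]
theorem toExtended_zero : toExtended (0 : EuclideanSpace ℝ (Fin d)) = 0 := by
  ext i; simp [toExtended]

theorem eventually_nhds_zero_extended_iff {p : (Fin d → EReal) → Prop} :
    (∀ᶠ z in 𝓝 0, p z) ↔ ∀ᶠ x in 𝓝 (0 : EuclideanSpace ℝ (Fin d)), p (toExtended x) := by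
  rw [← toExtended_zero, ← isOpenEmbedding_toExtended.map_nhds_eq, eventually_map]

/-- A compactly supported continuous function on `ℝ^d` extends continuously to `[-∞, ∞]^d`. -/
theorem exists_continuous_extension {f : EuclideanSpace ℝ (Fin d) → ℝ} (hf : Continuous f)
    (hs : HasCompactSupport f) :
    ∃ G : (Fin d → EReal) → ℝ, Continuous G ∧ ∀ x, G (toExtended x) = f x := by
  have he := isOpenEmbedding_toExtended (d := d)
  -- Continuity needs checking only on the topological support, which lies in the open image of
  -- `ℝ^d`.
  refine ⟨Function.extend toExtended f 0, continuous_of_tsupport fun z hz => ?_,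
    fun x => he.injective.extend_apply _ _ _⟩
  obtain ⟨x, -, rfl⟩ := hs.tsupport_extend_zero_subset he.continuous hz
  rw [← he.continuousAt_iff, Function.extend_comp he.injective]
  exact hf.continuousAt

theorem integral_puncturedExtension {E : Type*} [NormedAddCommGroup E] [NormedSpace ℝ E]
    (μ : Measure (EuclideanSpace ℝ (Fin d))) {G : (Fin d → EReal) → E}
    (hG : StronglyMeasurable G) (h0 : G 0 = 0) :
    ∫ z, G z.1 ∂(puncturedExtension μ) = ∫ x, G (toExtended x) ∂μ := by
  have emb := measurableEmbedding_puncturedVal d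
  rw [puncturedExtension, ← emb.integral_map, emb.map_comap,
    setIntegral_eq_integral_of_forall_compl_eq_zero,
    integral_map measurable_toExtended.aemeasurable hG.aestronglyMeasurable]
  intro z hz
  have : z = 0 := by simpa using hz
  rw [this, h0]

theorem integral_pointSum {G : (Fin d → EReal) → ℝ} (hG : Continuous G) (h0 : G 0 = 0) (n : ℕ)
    (x : ℕ → EuclideanSpace ℝ (Fin d)) :
    ∫ z, G z.1 ∂(pointSum n x).toMeasure = ∑ j ∈ Finset.Icc 1 n, G (toExtended (x j)) := by
  have hG' : Continuous fun x => G (toExtended x) :=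
    hG.comp isOpenEmbedding_toExtended.continuous
  change ∫ z, G z.1 ∂(puncturedExtension _) = _
  rw [integral_puncturedExtension _ hG.stronglyMeasurable h0, integral_finsetSum_measure]
  · simp
  · exact fun j _ => integrable_dirac (by simp)

/-- The complement of an open neighbourhood of `0` in `[-∞, ∞]^d` is compact, so vanishing near `0`
suffices and no decay at infinity is required. -/
theorem hasCompactSupport_punctured {E : Type*} [Zero E] {G : (Fin d → EReal) → E}
    (h0 : ∀ᶠ z in 𝓝 0, G z = 0) : HasCompactSupport fun z : Punctured d => G z.1 := by
  obtain ⟨U, hU, hUo, h0U⟩ := eventually_nhds_iff.1 h0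
  have hK : IsCompact ((Subtype.val : Punctured d → _) ⁻¹' Uᶜ) := by
    refine (IsEmbedding.subtypeVal.isInducing.isCompact_preimage_iff ?_).2
      hUo.isClosed_compl.isCompact
    intro z hz
    simp only [Subtype.range_coe_subtype, Set.mem_ofPred_eq]
    rintro rfl
    exact hz h0U
  refine HasCompactSupport.intro hK fun z hz => hU _ ?_
  simpa using hz

/-- The vague topology tests nonnegative functions only; the signed case follows by splitting into
positive and negative parts. -/
theorem continuous_pointMeasure_integral {G : (Fin d → EReal) → ℝ} (hG : Continuous G)
    (h0 : ∀ᶠ z in 𝓝 0, G z = 0) :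
    Continuous fun m : PointMeasure (Punctured d) => ∫ z, G z.1 ∂m.toMeasure := by
  have hpos : ∀ f : C_c(Punctured d, ℝ≥0),
      Continuous fun m : PointMeasure (Punctured d) => ∫ z, (f z : ℝ) ∂m.toMeasure :=
    fun f => continuous_iInf_dom continuous_induced_dom
  have mk : ∀ F : (Fin d → EReal) → ℝ, Continuous F → (∀ᶠ z in 𝓝 0, F z = 0) →
      Continuous fun m : PointMeasure (Punctured d) =>
        ∫ z, ((F z.1).toNNReal : ℝ) ∂m.toMeasure := fun F hF hF0 =>
    hpos ⟨⟨fun z => (F z.1).toNNReal, by fun_prop⟩, hasCompactSupport_punctured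
      (G := fun z => (F z).toNNReal) (hF0.mono fun z hz => by simp [hz])⟩
  have h1 := (mk G hG h0).sub (mk (fun z => - G z) hG.neg (h0.mono fun z hz => by simp [hz]))
  convert h1 using 2 with m
  have hm : IsFiniteMeasureOnCompacts m.toMeasure := ⟨fun K hK => m.finite_compact K hK⟩
  have hi : ∀ F : (Fin d → EReal) → ℝ, Continuous F → (∀ᶠ z in 𝓝 0, F z = 0) →
      Integrable (fun z : Punctured d => ((F z.1).toNNReal : ℝ)) m.toMeasure := fun F hF hF0 => by
    refine Continuous.integrable_of_hasCompactSupport (by fun_prop) ?_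
    exact hasCompactSupport_punctured (G := fun z => ((F z).toNNReal : ℝ))
      (hF0.mono fun z hz => by simp [hz])
  change _ = (∫ z, ((G z.1).toNNReal : ℝ) ∂m.toMeasure) - ∫ z, ((-G z.1).toNNReal : ℝ) ∂m.toMeasure
  rw [← integral_sub (hi G hG h0) (hi (fun z => - G z) hG.neg (h0.mono fun z hz => by simp [hz]))]
  refine integral_congr_ae (.of_forall fun z => ?_)
  simp only [Real.coe_toNNReal']
  rcases le_total 0 (G z.1) with h | h <;> simp [h]

end Extended

/-! ### Finiteness of a Lévy measure away from the origin. -/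

section Levy

variable {d : ℕ} {ν : Measure (EuclideanSpace ℝ (Fin d))}

theorem IsLevyMeasure.integrable_min (hν : IsLevyMeasure ν) :
    Integrable (fun x => min 1 (‖x‖ ^ 2)) ν := by
  refine ⟨by fun_prop, ?_⟩
  rw [hasFiniteIntegral_iff_ofReal (.of_forall fun x => by positivity)]
  exact hν.lintegral_lt_top

theorem IsLevyMeasure.measure_le_norm_lt_top (hν : IsLevyMeasure ν) {a : ℝ} (ha : 0 < a) :
    ν {x | a ≤ ‖x‖} < ∞ := by
  have hc : 0 < min 1 (a ^ 2) := by positivity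
  refine lt_of_le_of_lt (measure_mono ?_) (hν.integrable_min.measure_norm_ge_lt_top hc)
  intro x hx
  have hx : a ≤ ‖x‖ := hx
  have h2 : (0 : ℝ) ≤ min 1 (‖x‖ ^ 2) := by positivity
  simp only [Set.mem_ofPred_eq, Real.norm_of_nonneg h2]
  gcongr

/-- A Lévy measure is finite off the neighbourhoods of `0`. -/
theorem IsLevyMeasure.measure_lt_top_of_eventually (hν : IsLevyMeasure ν)
    {s : Set (EuclideanSpace ℝ (Fin d))} (hs : ∀ᶠ x in 𝓝 0, x ∉ s) : ν s < ∞ := by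
  obtain ⟨a, ha, h⟩ := Metric.eventually_nhds_iff.1 hs
  refine (measure_mono fun x hx => ?_).trans_lt (hν.measure_le_norm_lt_top ha)
  by_contra hlt
  exact h (by simpa using hlt) hx

end Levy

/-! ### Passing to the limit in continuous functionals of the point processes. -/

section Convergence

variable {d : ℕ} {Ω Ω'' : Type*} [MeasurableSpace Ω] [MeasurableSpace Ω'']
  {P : Measure Ω} [IsProbabilityMeasure P] {P'' : Measure Ω''} [IsProbabilityMeasure P'']
  {ν : Measure (EuclideanSpace ℝ (Fin d))}
  {η : ℕ → ℕ → Ω → EuclideanSpace ℝ (Fin d)}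
  {N' : Ω'' → PointMeasure (Punctured d)}

theorem puncturedExtension_ne_zero {G : (Fin d → EReal) → ℝ} (hG : Continuous G)
    (h0 : G 0 = 0) :
    puncturedExtension ν {z | G z.1 ≠ 0} = ν {x | G (toExtended x) ≠ 0} := by
  have hA : MeasurableSet {z : Punctured d | G z.1 ≠ 0} :=
    (isOpen_ne_fun (by fun_prop) continuous_const).measurableSet
  rw [puncturedExtension_apply _ hA]
  congr 1
  ext x
  simp only [Set.mem_ofPred_eq]
  refine ⟨fun ⟨_, h⟩ => h, fun h => ⟨fun h' => h ?_, h⟩⟩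
  rw [h', h0]

theorem tendstoInDistribution_sum
    (hconv : TendstoInDistribution (fun (n : ℕ) ω => pointSum n (fun j => η n j ω)) atTop N'
      (fun _ => P) P'')
    {G : (Fin d → EReal) → ℝ} (hG : Continuous G) (h0 : ∀ᶠ z in 𝓝 0, G z = 0) :
    TendstoInDistribution (fun n ω => ∑ j ∈ Finset.Icc 1 n, G (toExtended (η n j ω))) atTop
      (fun ω => ∫ z, G z.1 ∂(N' ω).toMeasure) (fun _ => P) P'' := by
  have h := hconv.continuous_comp (continuous_pointMeasure_integral hG h0)
  simp only [Function.comp_def] at h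
  simp_rw [integral_pointSum hG h0.self_of_nhds] at h
  exact h

theorem tendsto_integral_exp_sum (hν : IsLevyMeasure ν)
    (hN' : IsPoissonProcess N' (puncturedExtension ν) P'')
    (hconv : TendstoInDistribution (fun (n : ℕ) ω => pointSum n (fun j => η n j ω)) atTop N'
      (fun _ => P) P'')
    {G : (Fin d → EReal) → ℝ} (hG : Continuous G) (h0 : ∀ᶠ z in 𝓝 0, G z = 0) :
    Tendsto (fun n => ∫ ω, Complex.exp (Complex.I *
      ((∑ j ∈ Finset.Icc 1 n, G (toExtended (η n j ω)) : ℝ) : ℂ)) ∂P) atTop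
      (𝓝 (Complex.exp (∫ x, (Complex.exp (Complex.I * G (toExtended x)) - 1) ∂ν))) := by
  have h := tendstoInDistribution_sum hconv hG h0
  -- Frequency `1` suffices, because the vector `u` will be built into `G`.
  have h1 := ProbabilityMeasure.tendsto_iff_tendsto_charFun.1 h.tendsto 1
  simp only [ProbabilityMeasure.coe_mk, charFun_apply] at h1
  rw [integral_map h.aemeasurable_limit (by fun_prop)] at h1
  simp_rw [fun n => integral_map (h.forall_aemeasurable n)
    (f := fun x : ℝ => Complex.exp ((inner ℝ x (1 : ℝ) : ℝ) * Complex.I)) (by fun_prop)] at h1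
  simp only [Real.inner_apply, mul_one, mul_comm _ Complex.I] at h1
  obtain ⟨C, hC⟩ := (isCompact_range hG).isBounded.exists_norm_le
  have hA : MeasurableSet {z : Punctured d | G z.1 ≠ 0} :=
    (isOpen_ne_fun (by fun_prop) continuous_const).measurableSet
  have hfin : puncturedExtension ν {z | G z.1 ≠ 0} < ∞ := by
    rw [puncturedExtension_ne_zero hG h0.self_of_nhds]
    refine hν.measure_lt_top_of_eventually ?_
    filter_upwards [eventually_nhds_zero_extended_iff.1 h0] with x hx
    simpa using hx
  rw [hN'.integral_exp_integral (f := fun z => G z.1) (by fun_prop)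
    (fun z => hC _ ⟨z.1, rfl⟩) hA hfin (fun z hz => by simpa using hz)] at h1
  have hG1 : Continuous fun z => Complex.exp (Complex.I * G z) - 1 := by fun_prop
  rw [integral_puncturedExtension ν hG1.stronglyMeasurable (by simp [h0.self_of_nhds])] at h1
  exact h1

/-- Capping at `1` gives a bounded continuous functional, so weak convergence applies. Its limit is
at most the probability that `N'` charges the set where `G` is nonzero, hence at most the mean
measure of that set. -/
theorem eventually_integral_min_lt (hν : IsLevyMeasure ν)
    (hN' : IsPoissonProcess N' (puncturedExtension ν) P'')
    (hconv : TendstoInDistribution (fun (n : ℕ) ω => pointSum n (fun j => η n j ω)) atTop N'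
      (fun _ => P) P'')
    {G : (Fin d → EReal) → ℝ} (hG : Continuous G) (h0 : ∀ᶠ z in 𝓝 0, G z = 0)
    {r : ℝ} (hr : ν.real {x | G (toExtended x) ≠ 0} < r) :
    ∀ᶠ n in atTop, ∫ ω, min 1 |∑ j ∈ Finset.Icc 1 n, G (toExtended (η n j ω))| ∂P < r := by
  have h := tendstoInDistribution_sum hconv hG h0
  let b : BoundedContinuousFunction ℝ ℝ := BoundedContinuousFunction.ofNormedAddCommGroup
    (fun y => min 1 |y|) (by fun_prop) 1 (fun y => by
      rw [Real.norm_of_nonneg (by positivity)]; exact min_le_left _ _)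
  have h1 := ProbabilityMeasure.tendsto_iff_forall_integral_tendsto.1 h.tendsto b
  simp only [ProbabilityMeasure.coe_mk] at h1
  rw [integral_map h.aemeasurable_limit (by fun_prop)] at h1
  simp_rw [fun n => integral_map (h.forall_aemeasurable n)
    (f := (b : ℝ → ℝ)) (by fun_prop)] at h1
  refine h1.eventually_lt_const (lt_of_le_of_lt ?_ hr)
  have hA : MeasurableSet {z : Punctured d | G z.1 ≠ 0} :=
    (isOpen_ne_fun (by fun_prop) continuous_const).measurableSet
  have hfin : ν {x | G (toExtended x) ≠ 0} < ∞ := by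
    refine hν.measure_lt_top_of_eventually ?_
    filter_upwards [eventually_nhds_zero_extended_iff.1 h0] with x hx
    simpa using hx
  have heq := puncturedExtension_ne_zero (ν := ν) hG h0.self_of_nhds
  have hle := hN'.measure_ne_zero_le hA (heq ▸ hfin)
  rw [heq] at hle
  have hm := (hN'.law _ hA (heq ▸ hfin)).aemeasurable
  have hS : NullMeasurableSet {ω | (N' ω).toMeasure {z | G z.1 ≠ 0} ≠ 0} P'' :=
    (hm.nullMeasurable (measurableSet_singleton 0)).compl
  calc ∫ ω, b (∫ z, G z.1 ∂(N' ω).toMeasure) ∂P''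
      ≤ ∫ ω, {ω | (N' ω).toMeasure {z | G z.1 ≠ 0} ≠ 0}.indicator (fun _ => (1 : ℝ)) ω ∂P'' := by
        refine integral_mono_of_nonneg (.of_forall fun ω => ?_)
          ((integrable_const 1).indicator₀ hS) (.of_forall fun ω => ?_)
        · change 0 ≤ min 1 |_|
          positivity
        · by_cases hω : (N' ω).toMeasure {z | G z.1 ≠ 0} = 0
          · have : ∫ z, G z.1 ∂(N' ω).toMeasure = 0 :=
              integral_eq_zero_of_ae (by simpa [Filter.EventuallyEq, ae_iff] using hω)
            simp [this, hω, b]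
          · simp only [ne_eq, Set.mem_ofPred_eq, hω, not_false_eq_true, Set.indicator_of_mem]
            exact min_le_left _ _
    _ = P''.real {ω | (N' ω).toMeasure {z | G z.1 ≠ 0} ≠ 0} := by
        rw [integral_indicator₀ hS]; simp
    _ ≤ ν.real {x | G (toExtended x) ≠ 0} := ENNReal.toReal_mono hfin.ne hle

end Convergence

/-! ### Continuous cutoffs at the sphere of radius `ε` and at infinity. -/

section Cutoff

variable {d : ℕ} {ν : Measure (EuclideanSpace ℝ (Fin d))}

/-- A continuous, compactly supported approximation of `x ↦ ⟨u, x⟩ I(|x| > ε)`. -/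
noncomputable def innerCutoff (ε : ℝ) (u : EuclideanSpace ℝ (Fin d)) (k : ℕ)
    (x : EuclideanSpace ℝ (Fin d)) : ℝ :=
  inner ℝ u x * (max 0 (min 1 (k * (‖x‖ - ε))) * max 0 (min 1 (k + 1 - ‖x‖)))

/-- A continuous function, equal to `1` near the sphere `|x| = ε` and near infinity, and to `0`
away from these. -/
noncomputable def sphereCutoff (ε : ℝ) (k : ℕ) (x : EuclideanSpace ℝ (Fin d)) : ℝ :=
  max 0 (min 1 (max (2 - k * |‖x‖ - ε|) (‖x‖ - k + 1)))

theorem continuous_innerCutoff (ε : ℝ) (u : EuclideanSpace ℝ (Fin d)) (k : ℕ) :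
    Continuous (innerCutoff ε u k) := by
  unfold innerCutoff; fun_prop

theorem continuous_sphereCutoff (ε : ℝ) (k : ℕ) :
    Continuous (sphereCutoff ε k : EuclideanSpace ℝ (Fin d) → ℝ) := by
  unfold sphereCutoff; fun_prop

theorem hasCompactSupport_innerCutoff (ε : ℝ) (u : EuclideanSpace ℝ (Fin d)) (k : ℕ) :
    HasCompactSupport (innerCutoff ε u k) := by
  refine HasCompactSupport.intro (isCompact_closedBall 0 ((k : ℝ) + 1)) fun x hx => ?_
  have hx : (k : ℝ) + 1 < ‖x‖ := by simpa using hx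
  have : max (0 : ℝ) (min 1 (k + 1 - ‖x‖)) = 0 :=
    max_eq_left ((min_le_right _ _).trans (by linarith))
  simp [innerCutoff, this]

theorem hasCompactSupport_one_sub_sphereCutoff (ε : ℝ) (k : ℕ) :
    HasCompactSupport fun x : EuclideanSpace ℝ (Fin d) => 1 - sphereCutoff ε k x := by
  refine HasCompactSupport.intro (isCompact_closedBall 0 (k : ℝ)) fun x hx => ?_
  have hx : (k : ℝ) < ‖x‖ := by simpa using hx
  have h1 : 1 ≤ max (2 - k * |‖x‖ - ε|) (‖x‖ - k + 1) := le_max_of_le_right (by linarith)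
  simp [sphereCutoff, min_eq_left h1]

theorem innerCutoff_of_norm_le {ε : ℝ} (u : EuclideanSpace ℝ (Fin d)) (k : ℕ)
    {x : EuclideanSpace ℝ (Fin d)} (hx : ‖x‖ ≤ ε) : innerCutoff ε u k x = 0 := by
  have : (k : ℝ) * (‖x‖ - ε) ≤ 0 :=
    mul_nonpos_of_nonneg_of_nonpos (Nat.cast_nonneg _) (by linarith)
  have : max (0 : ℝ) (min 1 (k * (‖x‖ - ε))) = 0 := max_eq_left ((min_le_right _ _).trans this)
  simp [innerCutoff, this]

theorem innerCutoff_of_le {ε : ℝ} (u : EuclideanSpace ℝ (Fin d)) {k : ℕ}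
    {x : EuclideanSpace ℝ (Fin d)} (h1 : 1 ≤ k * (‖x‖ - ε)) (h2 : ‖x‖ ≤ k) :
    innerCutoff ε u k x = inner ℝ u x := by
  have h3 : (1 : ℝ) ≤ k + 1 - ‖x‖ := by linarith
  simp [innerCutoff, min_eq_left h1, min_eq_left h3]

theorem sphereCutoff_nonneg (ε : ℝ) (k : ℕ) (x : EuclideanSpace ℝ (Fin d)) :
    0 ≤ sphereCutoff ε k x := le_max_left _ _

/-- The two cutoffs are matched: a discrepancy forces `ε < |x|` and either `k(|x| - ε) < 1` or `|x|
> k`, and there one of the two pieces of `sphereCutoff` exceeds `1`. -/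
theorem one_le_sphereCutoff {ε : ℝ} {u : EuclideanSpace ℝ (Fin d)} {k : ℕ}
    {x : EuclideanSpace ℝ (Fin d)}
    (h : (if ε < ‖x‖ then inner ℝ u x else 0) ≠ innerCutoff ε u k x) :
    1 ≤ sphereCutoff ε k x := by
  by_cases hx : ε < ‖x‖
  · rw [if_pos hx] at h
    refine le_max_of_le_right (le_min le_rfl ?_)
    by_contra! hlt
    rw [max_lt_iff, abs_of_pos (sub_pos.2 hx)] at hlt
    exact h (innerCutoff_of_le u (by linarith) (by linarith)).symm
  · rw [if_neg hx, innerCutoff_of_norm_le u k (not_lt.1 hx)] at h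
    exact absurd rfl h

theorem sphereCutoff_ne_zero_iff {ε : ℝ} {k : ℕ} {x : EuclideanSpace ℝ (Fin d)} :
    sphereCutoff ε k x ≠ 0 ↔ k * |‖x‖ - ε| < 2 ∨ k < ‖x‖ + 1 := by
  rw [← (sphereCutoff_nonneg ε k x).lt_iff_ne', sphereCutoff, lt_max_iff, lt_min_iff, lt_max_iff]
  simp only [lt_self_iff_false, zero_lt_one, true_and, false_or]
  exact or_congr ⟨fun h => by linarith, fun h => by linarith⟩
    ⟨fun h => by linarith, fun h => by linarith⟩

theorem tendsto_innerCutoff (ε : ℝ) (u x : EuclideanSpace ℝ (Fin d)) :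
    Tendsto (fun k => innerCutoff ε u k x) atTop (𝓝 (if ε < ‖x‖ then inner ℝ u x else 0)) := by
  refine tendsto_const_nhds.congr' ?_
  by_cases hx : ε < ‖x‖
  · rw [if_pos hx]
    have h1 := tendsto_natCast_atTop_atTop (R := ℝ)
    filter_upwards [(h1.atTop_mul_const (sub_pos.2 hx)).eventually_ge_atTop 1,
      h1.eventually_ge_atTop ‖x‖] with k hk hk'
    exact (innerCutoff_of_le u hk hk').symm
  · rw [if_neg hx]
    exact .of_forall fun k => (innerCutoff_of_norm_le u k (not_lt.1 hx)).symm

theorem eventually_sphereCutoff_eq_zero {ε : ℝ} (hε : 0 < ε) :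
    ∀ᶠ k : ℕ in atTop, ∀ᶠ x in 𝓝 (0 : EuclideanSpace ℝ (Fin d)), sphereCutoff ε k x = 0 := by
  have h1 := tendsto_natCast_atTop_atTop (R := ℝ)
  filter_upwards [(h1.atTop_mul_const (half_pos hε)).eventually_ge_atTop 2,
    h1.eventually_ge_atTop (ε / 2 + 1)] with k hk hk'
  filter_upwards [Metric.ball_mem_nhds 0 (half_pos hε)] with x hx
  have hx : ‖x‖ < ε / 2 := by simpa using hx
  by_contra h
  rcases sphereCutoff_ne_zero_iff.1 h with h | h
  · have : (k : ℝ) * (ε / 2) ≤ k * |‖x‖ - ε| := by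
      gcongr
      rw [abs_of_neg (by linarith)]
      linarith
    linarith
  · linarith

/-- The sets decrease in `k`, their intersection lies in the null sphere, and for large `k` they
avoid a neighbourhood of `0` and so have finite measure. Continuity from above applies. -/
theorem tendsto_measure_sphereCutoff_ne_zero (hν : IsLevyMeasure ν) {ε : ℝ} (hε : 0 < ε)
    (hνε : ν {x | ‖x‖ = ε} = 0) :
    Tendsto (fun k => ν.real {x | sphereCutoff ε k x ≠ 0}) atTop (𝓝 0) := by
  have hfin : ∃ k : ℕ, ν {x | sphereCutoff ε k x ≠ 0} ≠ ∞ := by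
    obtain ⟨k, hk⟩ := (eventually_sphereCutoff_eq_zero (d := d) hε).exists
    exact ⟨k, (hν.measure_lt_top_of_eventually (hk.mono fun x hx => by simpa using hx)).ne⟩
  have hanti : Antitone fun k : ℕ => {x : EuclideanSpace ℝ (Fin d) | sphereCutoff ε k x ≠ 0} := by
    intro k l hkl x hx
    have hkl : (k : ℝ) ≤ l := by exact_mod_cast hkl
    refine sphereCutoff_ne_zero_iff.2 ((sphereCutoff_ne_zero_iff.1 hx).imp (fun h => ?_)
      fun h => hkl.trans_lt h)
    exact lt_of_le_of_lt (by gcongr) h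
  have hinter : ⋂ k : ℕ, {x : EuclideanSpace ℝ (Fin d) | sphereCutoff ε k x ≠ 0}
      ⊆ {x | ‖x‖ = ε} := by
    intro x hx
    by_contra hne
    have hpos : 0 < |‖x‖ - ε| := abs_pos.2 (sub_ne_zero.2 hne)
    have h1 := tendsto_natCast_atTop_atTop (R := ℝ)
    obtain ⟨k, hk, hk'⟩ := ((h1.atTop_mul_const hpos).eventually_ge_atTop 2 |>.and
      (h1.eventually_ge_atTop (‖x‖ + 1))).exists
    rcases sphereCutoff_ne_zero_iff.1 (Set.mem_iInter.1 hx k) with h | h <;> linarith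
  have := tendsto_measure_iInter_atTop (μ := ν) (fun k : ℕ =>
    (isOpen_ne_fun (continuous_sphereCutoff (d := d) ε k)
      continuous_const).measurableSet.nullMeasurableSet) hanti hfin
  rw [measure_mono_null hinter hνε] at this
  exact (ENNReal.tendsto_toReal ENNReal.zero_ne_top).comp this

end Cutoff

/-! ### Characteristic functions of the large-jump sums. -/

section Truncated

variable {d : ℕ} {Ω Ω'' : Type*} [MeasurableSpace Ω] [MeasurableSpace Ω'']
  {P : Measure Ω} [IsProbabilityMeasure P] {P'' : Measure Ω''} [IsProbabilityMeasure P'']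
  {ν : Measure (EuclideanSpace ℝ (Fin d))}
  {η : ℕ → ℕ → Ω → EuclideanSpace ℝ (Fin d)}
  {N' : Ω'' → PointMeasure (Punctured d)}

theorem norm_exp_I_mul_sub_exp_le_two (a b : ℝ) :
    ‖Complex.exp (Complex.I * a) - Complex.exp (Complex.I * b)‖ ≤ 2 := by
  refine (norm_sub_le _ _).trans ?_
  rw [Complex.norm_exp_I_mul_ofReal, Complex.norm_exp_I_mul_ofReal]
  norm_num

theorem integrable_exp_I_mul {f : Ω → ℝ} (hf : Measurable f) :
    Integrable (fun ω => Complex.exp (Complex.I * f ω)) P :=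
  .of_bound (by fun_prop) 1 (.of_forall fun _ => (Complex.norm_exp_I_mul_ofReal _).le)

/-- Sums of two functions over a point set have close characteristic functions if few points lie
where the functions differ. -/
theorem norm_integral_exp_sum_sub_le {ι E : Type*} [MeasurableSpace E] {s : Finset ι}
    {ξ : ι → Ω → E} (hξ : ∀ j ∈ s, Measurable (ξ j)) {f g h : E → ℝ} (hf : Measurable f)
    (hg : Measurable g) (hh : Measurable h) (h0 : ∀ x, 0 ≤ h x) (hfg : ∀ x, g x ≠ f x → 1 ≤ h x) :
    ‖∫ ω, Complex.exp (Complex.I * ((∑ j ∈ s, g (ξ j ω) : ℝ) : ℂ)) ∂P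
      - ∫ ω, Complex.exp (Complex.I * ((∑ j ∈ s, f (ξ j ω) : ℝ) : ℂ)) ∂P‖
      ≤ 2 * ∫ ω, min 1 |∑ j ∈ s, h (ξ j ω)| ∂P := by
  have hsum : ∀ {F : E → ℝ}, Measurable F → Measurable fun ω => ∑ j ∈ s, F (ξ j ω) :=
    fun hF => Finset.measurable_fun_sum _ fun j hj => hF.comp (hξ j hj)
  rw [← integral_sub (integrable_exp_I_mul (hsum hg)) (integrable_exp_I_mul (hsum hf)),
    ← integral_const_mul]
  refine norm_integral_le_of_norm_le (Integrable.const_mul ?_ 2) (.of_forall fun ω => ?_)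
  · refine .of_bound ((measurable_const.min (measurable_norm.comp (hsum hh))).aestronglyMeasurable)
      1 (.of_forall fun ω => ?_)
    rw [Real.norm_of_nonneg (by positivity)]
    exact min_le_left _ _
  · by_cases h : ∃ j ∈ s, g (ξ j ω) ≠ f (ξ j ω)
    · obtain ⟨j, hj, hne⟩ := h
      have h1 : 1 ≤ ∑ j ∈ s, h (ξ j ω) := (hfg _ hne).trans
        (Finset.single_le_sum (f := fun j => h (ξ j ω)) (fun i _ => h0 _) hj)
      rw [min_eq_left (h1.trans (le_abs_self _)), mul_one]
      exact norm_exp_I_mul_sub_exp_le_two _ _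
    · push Not at h
      rw [Finset.sum_congr rfl h, sub_self, norm_zero]
      positivity

/-- The characteristic functions of the sums of the large jumps converge. -/
theorem tendsto_integral_exp_largeJumps (hν : IsLevyMeasure ν)
    (hη : ∀ n j, 1 ≤ n → 1 ≤ j → Measurable (η n j))
    (hN' : IsPoissonProcess N' (puncturedExtension ν) P'')
    (hconv : TendstoInDistribution (fun (n : ℕ) ω => pointSum n (fun j => η n j ω)) atTop N'
      (fun _ => P) P'')
    {ε : ℝ} (hε : 0 < ε) (hνε : ν {x | ‖x‖ = ε} = 0) (u : EuclideanSpace ℝ (Fin d)) :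
    Tendsto (fun n => ∫ ω, Complex.exp (Complex.I *
      ((∑ j ∈ Finset.Icc 1 n, (if ε < ‖η n j ω‖ then inner ℝ u (η n j ω) else 0) : ℝ) : ℂ)) ∂P)
      atTop (𝓝 (Complex.exp (∫ x, (Complex.exp
        (Complex.I * (if ε < ‖x‖ then inner ℝ u x else 0 : ℝ)) - 1) ∂ν))) := by
  set g : EuclideanSpace ℝ (Fin d) → ℝ := fun x => if ε < ‖x‖ then inner ℝ u x else 0
  have hgm : Measurable g :=
    Measurable.ite (measurableSet_lt measurable_const measurable_norm) (by fun_prop) (by fun_prop)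
  have hexp : Continuous fun y : ℝ => Complex.exp (Complex.I * y) := by fun_prop
  have hlim : Tendsto (fun k => Complex.exp (∫ x, (Complex.exp
      (Complex.I * innerCutoff ε u k x) - 1) ∂ν)) atTop
      (𝓝 (Complex.exp (∫ x, (Complex.exp (Complex.I * g x) - 1) ∂ν))) := by
    refine (Complex.continuous_exp.tendsto _).comp ?_
    have hA : MeasurableSet {x : EuclideanSpace ℝ (Fin d) | ε ≤ ‖x‖} :=
      measurableSet_le measurable_const measurable_norm
    refine tendsto_integral_of_dominated_convergence ({x | ε ≤ ‖x‖}.indicator (fun _ => (2 : ℝ)))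
      (fun k => ?_) ((integrable_indicator_iff hA).2
        (integrableOn_const (hν.measure_le_norm_lt_top hε).ne))
      (fun k => .of_forall fun x => ?_)
      (.of_forall fun x => ((hexp.tendsto _).comp (tendsto_innerCutoff ε u x)).sub_const 1)
    · exact ((hexp.comp (continuous_innerCutoff ε u k)).sub continuous_const).aestronglyMeasurable
    · by_cases hx : ε ≤ ‖x‖
      · rw [Set.indicator_of_mem (by exact hx)]
        exact norm_exp_I_mul_sub_one_le_two _
      · rw [Set.indicator_of_notMem (by exact hx), innerCutoff_of_norm_le u k (not_le.1 hx).le]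
        simp
  rw [Metric.tendsto_atTop']
  intro r hr
  -- The cutoff level `k` is fixed before `n`. The error budget is `2 · r/6` for replacing the
  -- truncation by its cutoff, `r/3` for `n → ∞` at fixed `k`, and `r/3` for `k → ∞` in the limit.
  obtain ⟨k, hk1, hk2, hk3⟩ := ((Metric.tendsto_nhds.1 hlim (r / 3) (by positivity)).and
    (((tendsto_measure_sphereCutoff_ne_zero hν hε hνε).eventually_lt_const
      (show 0 < r / 6 by positivity)).and (eventually_sphereCutoff_eq_zero (d := d) hε))).exists
  obtain ⟨F, hFc, hF⟩ := exists_continuous_extension (continuous_innerCutoff ε u k)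
    (hasCompactSupport_innerCutoff ε u k)
  -- `sphereCutoff` is `1` near infinity, so it is its complement that has compact support and is
  -- extended; `1 - H` then also detects points far out.
  obtain ⟨H, hHc, hH⟩ := exists_continuous_extension
    (f := fun x => 1 - sphereCutoff ε k x)
    (continuous_const.sub (continuous_sphereCutoff (d := d) ε k))
    (hasCompactSupport_one_sub_sphereCutoff ε k)
  have hF0 : ∀ᶠ z in 𝓝 0, F z = 0 := by
    rw [eventually_nhds_zero_extended_iff]
    filter_upwards [Metric.ball_mem_nhds 0 hε] with x hx
    rw [hF]
    exact innerCutoff_of_norm_le u k (by simpa using (Metric.mem_ball.1 hx).le)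
  have hH' : ∀ x, 1 - H (toExtended x) = sphereCutoff ε k x := fun x => by rw [hH]; ring
  have hH0 : ∀ᶠ z in 𝓝 0, 1 - H z = 0 := by
    rw [eventually_nhds_zero_extended_iff]
    filter_upwards [hk3] with x hx
    rw [hH', hx]
  have h1 := tendsto_integral_exp_sum hν hN' hconv hFc hF0
  have h2 := eventually_integral_min_lt hν hN' hconv (G := fun z => 1 - H z)
    (continuous_const.sub hHc) hH0 (r := r / 6)
    (by simpa only [hH'] using hk2)
  simp only [hF] at h1
  simp only [hH'] at h2
  obtain ⟨n₀, hn₀⟩ := eventually_atTop.1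
    ((Metric.tendsto_nhds.1 h1 (r / 3) (by positivity)).and h2)
  refine ⟨n₀ + 1, fun n hn => ?_⟩
  obtain ⟨h3, h4⟩ := hn₀ n (by lia)
  have h5 := norm_integral_exp_sum_sub_le (P := P) (s := Finset.Icc 1 n) (ξ := η n)
    (fun j hj => hη n j (by lia) (Finset.mem_Icc.1 hj).1)
    (continuous_innerCutoff ε u k).measurable hgm (continuous_sphereCutoff ε k).measurable
    (sphereCutoff_nonneg ε k) (fun x hx => one_le_sphereCutoff hx)
  rw [← dist_eq_norm] at h5
  have h6 := (dist_triangle _ _ _).trans_lt (add_lt_add_of_le_of_lt h5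
    ((dist_triangle _ _ _).trans_lt (add_lt_add h3 hk1)))
  exact h6.trans (by linarith)

end Truncated

/-! ### The Lévy–Khintchine exponent and its truncations. -/

section LevyExponent

variable {d : ℕ} {ν : Measure (EuclideanSpace ℝ (Fin d))}

/-- Taylor's bound handles `|y| ≤ 1`; for `|y| ≥ 1` the crude bound `2 + |y| ≤ 3y²` explains the
constant. -/
theorem norm_exp_I_mul_sub_one_sub_le (y : ℝ) :
    ‖Complex.exp (Complex.I * y) - 1 - Complex.I * y‖ ≤ 3 * y ^ 2 := by
  have hn : ‖Complex.I * (y : ℂ)‖ = |y| := by simp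
  rcases le_total |y| 1 with h | h
  · have := Complex.norm_exp_sub_one_sub_id_le (hn.trans_le h)
    rw [hn, sq_abs] at this
    nlinarith [sq_nonneg y]
  · have h1 := norm_sub_le (Complex.exp (Complex.I * y) - 1) (Complex.I * y)
    have h2 := norm_exp_I_mul_sub_one_le_two y
    rw [hn] at h1
    nlinarith [sq_abs y]

/-- The integrand of the Lévy–Khintchine exponent. -/
noncomputable def levyKernel (u x : EuclideanSpace ℝ (Fin d)) : ℂ :=
  Complex.exp (Complex.I * (inner ℝ u x : ℝ)) - 1
    - (if ‖x‖ ≤ 1 then Complex.I * (inner ℝ u x : ℝ) else 0)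

theorem measurable_levyKernel (u : EuclideanSpace ℝ (Fin d)) : Measurable (levyKernel u) :=
  Measurable.sub (by fun_prop)
    (Measurable.ite (measurableSet_le measurable_norm measurable_const) (by fun_prop)
      (by fun_prop))

theorem norm_levyKernel_le (u x : EuclideanSpace ℝ (Fin d)) :
    ‖levyKernel u x‖ ≤ (3 * ‖u‖ ^ 2 + 2) * min 1 (‖x‖ ^ 2) := by
  unfold levyKernel
  split_ifs with hx
  · rw [min_eq_right (by nlinarith [norm_nonneg x])]
    have h1 := norm_exp_I_mul_sub_one_sub_le (inner ℝ u x)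
    have h2 : (inner ℝ u x : ℝ) ^ 2 ≤ (‖u‖ * ‖x‖) ^ 2 :=
      sq_le_sq' (by linarith [neg_le_of_abs_le (abs_real_inner_le_norm u x)])
        (real_inner_le_norm u x)
    nlinarith [sq_nonneg ‖x‖]
  · rw [min_eq_left (by nlinarith [not_le.1 hx]), sub_zero]
    have := norm_exp_I_mul_sub_one_le_two (inner ℝ u x)
    nlinarith [sq_nonneg ‖u‖]

theorem integrable_levyKernel (hν : IsLevyMeasure ν) (u : EuclideanSpace ℝ (Fin d)) :
    Integrable (levyKernel u) ν :=
  (hν.integrable_min.const_mul _).mono' (measurable_levyKernel u).aestronglyMeasurable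
    (.of_forall (norm_levyKernel_le u))

/-- The centring vector supplies exactly the compensator on `ε < |x| ≤ 1`. Both integrals converge
separately because `ν` is finite on `|x| > ε`. -/
theorem integral_exp_sub_one_sub_inner_integral (hν : IsLevyMeasure ν) {ε : ℝ} (hε : 0 < ε)
    (u : EuclideanSpace ℝ (Fin d)) :
    (∫ x, (Complex.exp (Complex.I * (if ε < ‖x‖ then inner ℝ u x else 0 : ℝ)) - 1) ∂ν)
      - Complex.I * (inner ℝ u (∫ x in {x | ε < ‖x‖ ∧ ‖x‖ ≤ 1}, x ∂ν) : ℝ)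
      = ∫ x, {x | ε < ‖x‖}.indicator (levyKernel u) x ∂ν := by
  have hS : MeasurableSet {x : EuclideanSpace ℝ (Fin d) | ε < ‖x‖ ∧ ‖x‖ ≤ 1} :=
    (measurableSet_lt measurable_const measurable_norm).inter
      (measurableSet_le measurable_norm measurable_const)
  have hT : MeasurableSet {x : EuclideanSpace ℝ (Fin d) | ε < ‖x‖} :=
    measurableSet_lt measurable_const measurable_norm
  have hTfin : ν {x | ε < ‖x‖} < ∞ :=
    (measure_mono (t := {x | ε ≤ ‖x‖}) fun x (hx : ε < ‖x‖) => hx.le).trans_lt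
      (hν.measure_le_norm_lt_top hε)
  have hSfin : ν {x | ε < ‖x‖ ∧ ‖x‖ ≤ 1} < ∞ := (measure_mono fun x hx => hx.1).trans_lt hTfin
  have hid : IntegrableOn (fun x => x) {x | ε < ‖x‖ ∧ ‖x‖ ≤ 1} ν :=
    .of_bound hSfin (by fun_prop) 1 ((ae_restrict_iff' hS).2 (.of_forall fun x hx => hx.2))
  have hinner : IntegrableOn (fun x => (inner ℝ u x : ℝ)) {x | ε < ‖x‖ ∧ ‖x‖ ≤ 1} ν :=
    hid.const_inner u
  have h1 : Integrable (fun x => Complex.exp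
      (Complex.I * (if ε < ‖x‖ then inner ℝ u x else 0 : ℝ)) - 1) ν := by
    have hgm : Measurable fun x : EuclideanSpace ℝ (Fin d) =>
        if ε < ‖x‖ then inner ℝ u x else 0 :=
      Measurable.ite hT (by fun_prop) (by fun_prop)
    refine (((integrable_indicator_iff hT).2 (integrableOn_const (C := (2 : ℝ))
      hTfin.ne))).mono' (by fun_prop) (.of_forall fun x => ?_)
    by_cases hx : ε < ‖x‖
    · rw [Set.indicator_of_mem (by exact hx)]
      exact norm_exp_I_mul_sub_one_le_two _
    · rw [Set.indicator_of_notMem (by exact hx), if_neg hx]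
      simp
  have h2 : Integrable ({x | ε < ‖x‖ ∧ ‖x‖ ≤ 1}.indicator
      fun x => Complex.I * ((inner ℝ u x : ℝ) : ℂ)) ν :=
    (integrable_indicator_iff hS).2 (hinner.ofReal.const_mul _)
  rw [← integral_inner hid, ← integral_complex_ofReal, ← integral_const_mul,
    ← integral_indicator hS, ← integral_sub h1 h2]
  refine integral_congr_ae (.of_forall fun x => ?_)
  by_cases hx : ε < ‖x‖ <;> by_cases hx' : ‖x‖ ≤ 1 <;>
    simp [levyKernel, Set.indicator, hx, hx']

/-- Dominated convergence with the integrable bound `‖levyKernel u x‖`. Each `x ≠ 0` is eventually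
inside the indicator, and the kernel vanishes at `0`. -/
theorem tendsto_integral_indicator_levyKernel (hν : IsLevyMeasure ν)
    (u : EuclideanSpace ℝ (Fin d)) (s : Set ℝ) :
    Tendsto (fun ε : ℝ => ∫ x, {x | ε < ‖x‖}.indicator (levyKernel u) x ∂ν) (𝓝[s] 0)
      (𝓝 (levyExponent ν u)) := by
  refine tendsto_integral_filter_of_dominated_convergence (fun x => ‖levyKernel u x‖)
    (.of_forall fun ε => ?_) (.of_forall fun ε => .of_forall fun x => ?_)
    (integrable_levyKernel hν u).norm (.of_forall fun x => ?_)
  · exact ((measurable_levyKernel u).indicator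
      (measurableSet_lt measurable_const measurable_norm)).aestronglyMeasurable
  · exact norm_indicator_le_norm_self _ _
  · refine tendsto_const_nhds.congr' ?_
    by_cases hx : x = 0
    · subst hx
      refine .of_forall fun ε => ?_
      by_cases h : ε < ‖(0 : EuclideanSpace ℝ (Fin d))‖ <;> simp [levyKernel, Set.indicator]
    · filter_upwards [mem_nhdsWithin_of_mem_nhds (Iio_mem_nhds (norm_pos_iff.2 hx))] with ε hε
      rw [Set.indicator_of_mem (by exact hε)]
      rfl

/-- All but countably many spheres are null sets, so that radii of null spheres accumulate at
`0`. -/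
theorem nhdsWithin_nullSphere_neBot (hν : IsLevyMeasure ν) :
    (𝓝[{ε : ℝ | 0 < ε ∧ ν {x | ‖x‖ = ε} = 0}] 0).NeBot := by
  have := hν.sigmaFinite
  have hc := Measure.countable_meas_level_set_pos (μ := ν)
    (g := fun x : EuclideanSpace ℝ (Fin d) => ‖x‖) measurable_norm
  have hd := hc.dense_compl ℝ
  rw [← mem_closure_iff_nhdsWithin_neBot]
  have h0 : (0 : ℝ) ∈ closure (Set.Ioi 0) := by simp
  refine closure_minimal ((hd.open_subset_closure_inter isOpen_Ioi).trans (closure_mono ?_))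
    isClosed_closure h0
  rintro ε ⟨hε, h⟩
  exact ⟨hε, by simpa using h⟩

end LevyExponent

/-! ### Removing the small jumps and concluding. -/

theorem norm_integral_exp_add_sub_le {Ω : Type*} [MeasurableSpace Ω] {P : Measure Ω}
    [IsProbabilityMeasure P] {A B : Ω → ℝ} (hA : Measurable A) (hB : Measurable B) {s : Set Ω}
    (hs : MeasurableSet s) {κ : ℝ} (hκ : 0 ≤ κ) (hBs : ∀ ω, ω ∉ s → |B ω| ≤ κ) :
    ‖∫ ω, Complex.exp (Complex.I * ((A ω + B ω : ℝ) : ℂ)) ∂P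
      - ∫ ω, Complex.exp (Complex.I * (A ω : ℂ)) ∂P‖ ≤ κ + 2 * P.real s := by
  rw [← integral_sub (integrable_exp_I_mul (f := fun ω => A ω + B ω) (hA.add hB))
    (integrable_exp_I_mul hA)]
  have hi : Integrable (fun ω => κ + s.indicator (fun _ => (2 : ℝ)) ω) P :=
    (integrable_const _).add ((integrable_const _).indicator hs)
  refine (norm_integral_le_of_norm_le hi (.of_forall fun ω => ?_)).trans_eq ?_
  -- Factoring out the unimodular `e^{iA}` leaves `|e^{iB} - 1|`, at most `κ` off `s` and at most
  -- `2` on it.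
  · have e : Complex.exp (Complex.I * ((A ω + B ω : ℝ) : ℂ)) - Complex.exp (Complex.I * (A ω : ℂ))
        = Complex.exp (Complex.I * (A ω : ℂ)) * (Complex.exp (Complex.I * (B ω : ℂ)) - 1) := by
      push_cast
      rw [mul_add, Complex.exp_add]
      ring
    rw [e, norm_mul, Complex.norm_exp_I_mul_ofReal, one_mul]
    by_cases hω : ω ∈ s
    · rw [Set.indicator_of_mem hω]
      linarith [norm_exp_I_mul_sub_one_le_two (B ω)]
    · rw [Set.indicator_of_notMem hω, add_zero]
      exact Real.norm_exp_I_mul_ofReal_sub_one_le.trans (hBs ω hω)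
  · rw [integral_add (integrable_const _) ((integrable_const _).indicator hs),
      integral_indicator hs]
    simp [mul_comm]

theorem partialSumProcess_one {d : ℕ} {Ω : Type*} (η : ℕ → ℕ → Ω → EuclideanSpace ℝ (Fin d))
    (c : ℕ → EuclideanSpace ℝ (Fin d)) (n : ℕ) (ω : Ω) :
    partialSumProcess η c n 1 ω = ∑ j ∈ Finset.Icc 1 n, η n j ω - c n := by
  simp [partialSumProcess]

/-- Separation of the large and the small jumps in `⟨u, X_n(1)⟩`. -/
theorem inner_partialSumProcess_one {d : ℕ} {Ω : Type*}
    (η : ℕ → ℕ → Ω → EuclideanSpace ℝ (Fin d)) (c : ℕ → EuclideanSpace ℝ (Fin d)) (n : ℕ) (ω : Ω)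
    (u b : EuclideanSpace ℝ (Fin d)) (ε : ℝ) :
    inner ℝ u (partialSumProcess η c n 1 ω) =
      (∑ j ∈ Finset.Icc 1 n, (if ε < ‖η n j ω‖ then inner ℝ u (η n j ω) else 0) - inner ℝ u b)
      + inner ℝ u ((∑ j ∈ Finset.Icc 1 n, if ‖η n j ω‖ ≤ ε then η n j ω else 0) - c n + b) := by
  have h : ∑ j ∈ Finset.Icc 1 n, (inner ℝ u (η n j ω) : ℝ) =
      ∑ j ∈ Finset.Icc 1 n, (if ε < ‖η n j ω‖ then inner ℝ u (η n j ω) else 0)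
      + ∑ j ∈ Finset.Icc 1 n, inner ℝ u (if ‖η n j ω‖ ≤ ε then η n j ω else 0) := by
    rw [← Finset.sum_add_distrib]
    refine Finset.sum_congr rfl fun j _ => ?_
    by_cases hj : ε < ‖η n j ω‖
    · simp [hj, not_le.2 hj]
    · simp [hj, not_lt.1 hj]
  rw [partialSumProcess_one, inner_sub_right, inner_sum, h, inner_add_right, inner_sub_right,
    inner_sum]
  ring

theorem theorem3p2 {d : ℕ} {Ω Ω' Ω'' : Type*}
    [MeasurableSpace Ω] [MeasurableSpace Ω'] [MeasurableSpace Ω'']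
    (P : Measure Ω) [IsProbabilityMeasure P]
    (P' : Measure Ω') [IsProbabilityMeasure P']
    (P'' : Measure Ω'') [IsProbabilityMeasure P'']
    (ν : Measure (EuclideanSpace ℝ (Fin d))) (hν : IsLevyMeasure ν)
    (hν_sphere : ν {x | ‖x‖ = 1} = 0)
    (X : ℝ≥0 → Ω' → EuclideanSpace ℝ (Fin d)) (hX : IsLevyProcess X P')
    (hX_char : ∀ u, charFun (P'.map (X 1)) u = Complex.exp (levyExponent ν u))
    (η : ℕ → ℕ → Ω → EuclideanSpace ℝ (Fin d))
    (hη : ∀ n j, 1 ≤ n → 1 ≤ j → Measurable (η n j))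
    (hη_ne : ∀ n j, 1 ≤ n → 1 ≤ j → ∀ᵐ ω ∂P, η n j ω ≠ 0)
    (c : ℕ → EuclideanSpace ℝ (Fin d))
    (N' : Ω'' → PointMeasure (Punctured d))
    (hN' : IsPoissonProcess N' (puncturedExtension ν) P'')
    (hconv : TendstoInDistribution (fun (n : ℕ) ω => pointSum n (fun j => η n j ω)) atTop N'
      (fun _ => P) P'')
    (hsmall : ∀ δ : ℝ, 0 < δ →
      Tendsto
        (fun ε : ℝ => limsup (fun n : ℕ =>
          P {ω | δ ≤ ‖(∑ j ∈ Finset.Icc 1 n, if ‖η n j ω‖ ≤ ε then η n j ω else 0)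
            - c n + ∫ x in {x | ε < ‖x‖ ∧ ‖x‖ ≤ 1}, x ∂ν‖}) atTop)
        (𝓝[{ε : ℝ | 0 < ε ∧ ν {x | ‖x‖ = ε} = 0}] 0) (𝓝 0)) :
    TendstoInDistribution (fun n => partialSumProcess η c n 1) atTop (X 1) (fun _ => P) P' := by
  have hη' : ∀ n, ∀ j ∈ Finset.Icc 1 n, Measurable (η n j) := fun n j hj => by
    rw [Finset.mem_Icc] at hj
    exact hη n j (hj.1.trans hj.2) hj.1
  have hXn : ∀ n, Measurable (partialSumProcess η c n 1) := fun n => by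
    rw [funext (partialSumProcess_one η c n)]
    exact (Finset.measurable_fun_sum _ (hη' n)).sub_const _
  refine ⟨fun n => (hXn n).aemeasurable, (hX.measurable 1).aemeasurable,
    ProbabilityMeasure.tendsto_of_tendsto_charFun fun u => ?_⟩
  simp only [ProbabilityMeasure.coe_mk]
  rw [hX_char u]
  have hchar : ∀ n, charFun (P.map (partialSumProcess η c n 1)) u =
      ∫ ω, Complex.exp (Complex.I * (inner ℝ u (partialSumProcess η c n 1 ω) : ℝ)) ∂P := fun n => by
    rw [charFun_apply, integral_map (hXn n).aemeasurable (by fun_prop)]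
    simp only [mul_comm Complex.I, real_inner_comm]
  simp_rw [hchar]
  rw [Metric.tendsto_nhds]
  intro r hr
  -- Chosen so that a remainder of norm below `δ` moves the phase by at most `r/4`; the `+ 1` covers
  -- `u = 0`.
  set δ : ℝ := r / (4 * (‖u‖ + 1)) with hδ_def
  have hδ : 0 < δ := by positivity
  have huδ : ‖u‖ * δ ≤ r / 4 := by
    rw [hδ_def, mul_div_assoc', div_le_div_iff₀ (by positivity) (by norm_num)]
    nlinarith [norm_nonneg u]
  have := nhdsWithin_nullSphere_neBot hν
  have hlim := (Complex.continuous_exp.tendsto _).comp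
    (tendsto_integral_indicator_levyKernel hν u {ε : ℝ | 0 < ε ∧ ν {x | ‖x‖ = ε} = 0})
  -- One `ε` is fixed before `n`; it exists because null radii accumulate at `0`. The budget is
  -- `r/4` for truncating the exponent, `r/4 + 2 · r/8` for the remainder, and `r/4` for the large
  -- jumps.
  obtain ⟨ε, h1, h2, hε, hνε⟩ := ((Metric.tendsto_nhds.1 hlim (r / 4) (by positivity)).and
    (((hsmall δ hδ).eventually_lt_const (ENNReal.ofReal_pos.2 (show 0 < r / 8 by positivity))).and
      self_mem_nhdsWithin)).exists
  set b := ∫ x in {x | ε < ‖x‖ ∧ ‖x‖ ≤ 1}, x ∂ν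
  have h3 := (tendsto_integral_exp_largeJumps hν hη hN' hconv hε hνε u).mul_const
    (Complex.exp (-(Complex.I * (inner ℝ u b : ℝ))))
  rw [← Complex.exp_add, ← sub_eq_add_neg, integral_exp_sub_one_sub_inner_integral hν hε u] at h3
  filter_upwards [Metric.tendsto_nhds.1 h3 (r / 4) (by positivity),
    eventually_lt_of_limsup_lt h2] with n h4 h5
  have hA : Measurable fun ω => ∑ j ∈ Finset.Icc 1 n,
      (if ε < ‖η n j ω‖ then inner ℝ u (η n j ω) else 0) - inner ℝ u b := by
    refine (Finset.measurable_fun_sum _ fun j hj => ?_).sub_const _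
    have := hη' n j hj
    exact Measurable.ite (measurableSet_lt measurable_const this.norm) (by fun_prop) (by fun_prop)
  have hR : Measurable fun ω =>
      (∑ j ∈ Finset.Icc 1 n, if ‖η n j ω‖ ≤ ε then η n j ω else 0) - c n + b := by
    refine ((Finset.measurable_fun_sum _ fun j hj => ?_).sub_const _).add_const _
    have := hη' n j hj
    exact Measurable.ite (measurableSet_le this.norm measurable_const) (by fun_prop) (by fun_prop)
  have h6 := norm_integral_exp_add_sub_le (P := P) hA (hR.const_inner (c := u))
    (measurableSet_le measurable_const hR.norm) (κ := ‖u‖ * δ) (by positivity) fun ω hω =>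
      (abs_real_inner_le_norm _ _).trans
        (mul_le_mul_of_nonneg_left (not_le.1 hω).le (norm_nonneg u))
  have h7 : P.real {ω | δ ≤ ‖(∑ j ∈ Finset.Icc 1 n, if ‖η n j ω‖ ≤ ε then η n j ω else 0)
      - c n + b‖} < r / 8 :=
    (ENNReal.lt_ofReal_iff_toReal_lt (measure_ne_top _ _)).1 h5
  simp_rw [← inner_partialSumProcess_one η c n _ u b ε] at h6
  have h8 : ∫ ω, Complex.exp (Complex.I * ((∑ j ∈ Finset.Icc 1 n,
        (if ε < ‖η n j ω‖ then inner ℝ u (η n j ω) else 0) - inner ℝ u b : ℝ) : ℂ)) ∂P =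
      (∫ ω, Complex.exp (Complex.I * ((∑ j ∈ Finset.Icc 1 n,
        (if ε < ‖η n j ω‖ then inner ℝ u (η n j ω) else 0) : ℝ) : ℂ)) ∂P)
      * Complex.exp (-(Complex.I * (inner ℝ u b : ℝ))) := by
    rw [← integral_mul_const]
    congr 1 with ω
    rw [← Complex.exp_add, Complex.ofReal_sub, mul_sub, sub_eq_add_neg]
  rw [h8, ← dist_eq_norm] at h6
  have h9 := (dist_triangle _ _ _).trans_lt (add_lt_add_of_le_of_lt h6
    ((dist_triangle _ _ _).trans_lt (add_lt_add h4 h1)))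
  exact h9.trans (by linarith)
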